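/- Every hypertree is $k$-cordial for $k \in \{2,3\}$. Here a hypergraph is a pair $H=(V,E)$ with $V$ a finite set and $E$ a set of subsets of $V$ (called edges), each of cardinality at least $2$. The incidence graph of $H$ is the bipartite graph with vertex set $V \sqcup E$ in which $v \in V$ is adjacent to $e \in E$ if and only if $v \in e$. A hypertree is a hypergraph whose incidence graph is connected and has no cycles, that is, is a tree (in particular $V \neq \emptyset$). A vertex labeling $f : V \to \mathbb{Z}_k$ induces the edge labeling $f(e) = \sum_{v \in e} f(v) \in \mathbb{Z}_k$ for $e \in E$. The labeling $f$ is called $k$-cordial if for all $a, b \in \mathbb{Z}_k$ the number of vertices with label $a$ differs by at most $1$ from the number of vertices with label $b$, and the number of edges with label $a$ differs by at most $1$ from the number of edges with label $b$. A hypergraph is called $k$-cordial if it admits a $k$-cordial labeling. -/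

import Mathlib

namespace Hypergraph

/-- The incidence graph of a hypergraph `H`: its vertices are the vertices and the edges of `H`,
and a vertex `v` is joined to an edge `e` exactly when `v ∈ e`. -/
def incidenceGraph {α : Type*} (H : Hypergraph α) :
    SimpleGraph (H.vertexSet ⊕ H.edgeSet) where
  Adj x y := match x, y with
    | Sum.inl v, Sum.inr e => (v : α) ∈ (e : Set α)
    | Sum.inr e, Sum.inl v => (v : α) ∈ (e : Set α)
    | _, _ => False
  symm := ⟨by rintro (v | e) (w | f) h <;> exact h⟩
  loopless := ⟨by rintro (v | e) h <;> exact h⟩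

/-- A hypergraph is a hypertree if it is connected and has no cycles, where connectedness and
cycles are understood in its incidence graph. -/
def IsHypertree {α : Type*} (H : Hypergraph α) : Prop :=
  H.incidenceGraph.Connected ∧ H.incidenceGraph.IsAcyclic

/-- The label that a vertex labeling `f` induces on an edge `e`: the sum in `ZMod k` of the labels
of the vertices in `e`. -/
noncomputable def edgeLabel {α : Type*} (H : Hypergraph α) {k : ℕ} (f : H.vertexSet → ZMod k)
    (e : H.edgeSet) : ZMod k :=
  ∑ᶠ (v : H.vertexSet) (_ : (v : α) ∈ (e : Set α)), f v

/-- The number of vertices with label `a`. -/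
noncomputable def vertexCount {α : Type*} (H : Hypergraph α) {k : ℕ} (f : H.vertexSet → ZMod k)
    (a : ZMod k) : ℕ :=
  {v : H.vertexSet | f v = a}.ncard

/-- The number of edges with induced label `a`. -/
noncomputable def edgeCount {α : Type*} (H : Hypergraph α) {k : ℕ} (f : H.vertexSet → ZMod k)
    (a : ZMod k) : ℕ :=
  {e : H.edgeSet | H.edgeLabel f e = a}.ncard

/-- A vertex labeling of a (finite) hypergraph is `k`-cordial if the numbers of vertices with any
two given labels differ by at most `1`, and likewise for the numbers of edges. -/
def IsCordialLabeling {α : Type*} (H : Hypergraph α) {k : ℕ} (f : H.vertexSet → ZMod k) : Prop :=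
  ∀ a b : ZMod k,
    |(H.vertexCount f a : ℤ) - (H.vertexCount f b : ℤ)| ≤ 1 ∧
    |(H.edgeCount f a : ℤ) - (H.edgeCount f b : ℤ)| ≤ 1

/-- A (finite) hypergraph is `k`-cordial if it admits a `k`-cordial labeling. -/
def IsCordial {α : Type*} (H : Hypergraph α) (k : ℕ) : Prop :=
  ∃ f : H.vertexSet → ZMod k, H.IsCordialLabeling f

end Hypergraph

/-!
Root the incidence tree at a vertex. A branch of it which is attached at a vertex `v` influences the
rest of the labeling only through the sets of profiles (differences between the numbers of
labels of its vertices, and of its edges) which it can achieve for each label of `v`. For a branch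
attached at an edge `e`, the label of `v` is replaced by the sum of the labels of the vertices of
`e` outside the branch. Attaching a completed edge to a vertex adds such states pointwise, and
attaching a vertex to an edge is a convolution over the label of the vertex.

Shrinking states only discards profiles. It therefore suffices to find finite families of states
which are closed under both operations up to shrinking, and whose vertex states all contain
the profile of a cordial labeling. Such families exist for `k = 2` and `k = 3`; they were found
by a computer search which keeps only profiles close to `0`.
-/

namespace HypertreeCordial

open Finset
open scoped Pointwise

section Tree

variable {V : Type*} {G : SimpleGraph V} {r : V}

theorem existsUnique_adj_dist_lt (hG : G.IsTree) {x : V} (hx : x ≠ r) :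
    ∃! y, G.Adj x y ∧ G.dist r y < G.dist r x := by
  obtain ⟨p, hp, hlen⟩ := hG.connected.exists_path_of_dist r x
  have hnil : ¬p.Nil := SimpleGraph.Walk.not_nil_of_ne hx.symm
  have hpos : 0 < G.dist r x := hG.connected.pos_dist_of_ne hx.symm
  refine ⟨p.penultimate, ⟨(p.adj_penultimate hnil).symm, ?_⟩, fun z ⟨hxz, hz⟩ ↦ ?_⟩
  · have := SimpleGraph.dist_le p.dropLast
    rw [SimpleGraph.Walk.length_dropLast] at this
    omega
  · obtain ⟨q, hq, hqlen⟩ := hG.connected.exists_path_of_dist r z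
    have hxq : x ∉ q.support := fun hmem ↦ by
      classical
      have h₁ := SimpleGraph.dist_le (q.takeUntil x hmem)
      have h₂ := q.length_takeUntil_le_length hmem
      exact hz.not_ge (by omega)
    have hzp := hG.isAcyclic.mem_support_of_ne_mem_support_of_adj_of_isPath hp hq hxz hxq
    exact hG.isAcyclic.eq_penultimate_of_adj_end hp hxz hzp

theorem leaf_induction_of_isTree [Fintype V] [DecidableEq V] (hG : G.IsTree) {P : Finset V → Prop}
    (singleton : P {r})
    (insert : ∀ s a u, r ∈ s → a ∈ s → u ∉ s → (∀ w ∈ s, G.Adj u w ↔ w = a) → P s →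
      P (insert u s)) :
    P univ := by
  suffices ∀ s : Finset V, s.Nonempty → (∀ x ∉ s, ∀ y ∈ s, G.dist r y ≤ G.dist r x) →
      r ∈ s ∧ P s from (this univ ⟨r, mem_univ r⟩ (by simp)).2
  intro s
  induction s using Finset.induction_on_max_value (fun x ↦ G.dist r x) with
  | empty => simp
  | insert u s hu hmax ih =>
    intro _ hclosed
    have hsclosed : ∀ x ∉ s, ∀ y ∈ s, G.dist r y ≤ G.dist r x := fun x hx y hy ↦ by
      obtain rfl | hxu := eq_or_ne x u
      · exact hmax y hy
      · exact hclosed x (by simp [hxu, hx]) y (mem_insert_of_mem hy)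
    obtain rfl | hur := eq_or_ne u r
    · obtain rfl | hs := s.eq_empty_or_nonempty
      · simpa using singleton
      · exact absurd (ih hs hsclosed).1 hu
    obtain ⟨a, ⟨hua, ha⟩, huniq⟩ := existsUnique_adj_dist_lt hG hur
    have has : a ∈ s := by
      by_contra has
      have := hclosed a (by simp [hua.ne', has]) u (mem_insert_self u s)
      omega
    obtain ⟨hrs, hPs⟩ := ih ⟨a, has⟩ hsclosed
    refine ⟨mem_insert_of_mem hrs, insert s a u hrs has hu (fun w hw ↦ ⟨fun huw ↦ ?_, ?_⟩) hPs⟩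
    · exact huniq w ⟨huw, (hmax w hw).lt_of_ne (hG.dist_ne_of_adj r huw).symm⟩
    · rintro rfl
      exact hua

end Tree

section States

variable {R M : Type*} [AddCommMonoid R] [AddCommMonoid M]

/-- The set of achievable profiles of a partially labeled branch, as a function of the label of the
vertex at which the branch is attached, or of the label which the vertices outside the branch
contribute to the edge at which it is attached. -/
abbrev State (R M : Type*) := R → Set M

/-- The state of an edge in state `F` after a further vertex of it, in state `U`, joins the
branch. -/
def merge (F U : State R M) : State R M := fun y ↦ ⋃ x, F (y + x) + U x

/-- Families `𝒰` of vertex states and `ℱ` of edge states which, up to shrinking states, contain the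
state of a lone vertex and are closed under the two ways of extending a branch. The profile of a
label is `a` at a vertex and `b` at an edge. -/
structure IsClosedSystem (a b : R → M) (𝒰 ℱ : Set (State R M)) : Prop where
  exists_le_vertex : ∃ U ∈ 𝒰, U ≤ fun x ↦ {a x}
  exists_le_add : ∀ U ∈ 𝒰, ∀ F ∈ ℱ, ∃ U' ∈ 𝒰, U' ≤ U + F
  exists_le_merge : ∀ F ∈ insert (fun y ↦ {b y}) ℱ, ∀ U ∈ 𝒰, ∃ F' ∈ ℱ, F' ≤ merge F U

variable {α : Type*} {H : Hypergraph α}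

open Classical in
/-- The vertices of the edge `e` which belong to the set `s` of nodes of the incidence graph. -/
noncomputable def members (s : Finset (H.vertexSet ⊕ H.edgeSet)) (e : H.edgeSet) :
    Finset H.vertexSet :=
  {v ∈ s.toLeft | (v : α) ∈ (e : Set α)}

/-- The profiles achievable by the labeling `f` of the vertices in `s`, if the state `σ v` or `τ e`
accounts for the branches outside `s` attached at the node `v` or `e` of `s`. -/
noncomputable def values (σ : H.vertexSet → State R M) (τ : H.edgeSet → State R M)
    (s : Finset (H.vertexSet ⊕ H.edgeSet)) (f : H.vertexSet → R) : Set M :=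
  ∑ v ∈ s.toLeft, σ v (f v) + ∑ e ∈ s.toRight, τ e (∑ v ∈ members s e, f v)

/-- Branches hanging from the nodes in `s`, in whatever states, can be absorbed into a single vertex
state at `r`. An edge in its initial state must have two vertices in `s`: once only one of them is
left, the edge is itself absorbed into that vertex, and its state must belong to `ℱ`. -/
def IsAbsorbable (b : R → M) (𝒰 ℱ : Set (State R M)) (r : H.vertexSet)
    (s : Finset (H.vertexSet ⊕ H.edgeSet)) : Prop :=
  ∀ (σ : H.vertexSet → State R M) (τ : H.edgeSet → State R M), (∀ v, σ v ∈ 𝒰) →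
    (∀ e, .inr e ∈ s → τ e ∈ ℱ ∨ τ e = (fun y ↦ {b y}) ∧ 2 ≤ #(members s e)) →
    ∃ U ∈ 𝒰, ∀ x, ∀ p ∈ U x, ∃ f : H.vertexSet → R, f r = x ∧ p ∈ values σ τ s f

variable {a b : R → M} {𝒰 ℱ : Set (State R M)} {r : H.vertexSet}
  {s : Finset (H.vertexSet ⊕ H.edgeSet)} {v₀ : H.vertexSet} {e₀ : H.edgeSet}

theorem members_eq_singleton (hv₀ : .inl v₀ ∈ s)
    (hadj : ∀ v : H.vertexSet, .inl v ∈ s → ((v : α) ∈ (e₀ : Set α) ↔ v = v₀)) :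
    members s e₀ = {v₀} := by
  ext v
  simp only [members, mem_filter, mem_toLeft, mem_singleton]
  exact ⟨fun h ↦ (hadj v h.1).1 h.2, fun h ↦ h ▸ ⟨hv₀, (hadj v₀ hv₀).2 rfl⟩⟩

theorem two_le_card_members_univ [Fintype H.vertexSet] [Fintype H.edgeSet] {e : H.edgeSet}
    (he : 2 ≤ (e : Set α).ncard) :
    2 ≤ #(members univ e) := by
  classical
  have himage : (members univ e).image Subtype.val = (e : Set α) := by
    ext x
    simp [members]
  rw [← himage, Set.ncard_coe_finset] at he
  exact he.trans card_image_le

theorem isAbsorbable_singleton : IsAbsorbable b 𝒰 ℱ r {.inl r} := by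
  intro σ τ hσ _
  refine ⟨σ r, hσ r, fun x p hp ↦ ⟨fun _ ↦ x, rfl, ?_⟩⟩
  have hleft : ({.inl r} : Finset (H.vertexSet ⊕ H.edgeSet)).toLeft = {r} := by ext; simp
  have hright : ({.inl r} : Finset (H.vertexSet ⊕ H.edgeSet)).toRight = ∅ := by ext; simp
  simpa [values, hleft, hright] using hp

section DecidableEq

variable [DecidableEq H.vertexSet] [DecidableEq H.edgeSet]
  {σ : H.vertexSet → State R M} {τ : H.edgeSet → State R M}

theorem members_insert_inr (e₀ e : H.edgeSet) :
    members (insert (.inr e₀) s) e = members s e := by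
  simp only [members, toLeft_insert_inr]

theorem sum_members_insert_inl_of_mem (hv₀ : .inl v₀ ∉ s) (he : (v₀ : α) ∈ (e₀ : Set α))
    (f : H.vertexSet → R) (x : R) :
    ∑ v ∈ members (insert (.inl v₀) s) e₀, Function.update f v₀ x v =
      x + ∑ v ∈ members s e₀, f v := by
  have hnot : v₀ ∉ members s e₀ := by simp [members, hv₀]
  have hmem : members (insert (.inl v₀) s) e₀ = insert v₀ (members s e₀) := by
    simp only [members, toLeft_insert_inl, filter_insert, if_pos he]
  rw [hmem, sum_insert hnot, sum_update_of_notMem hnot, Function.update_self]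

theorem sum_members_insert_inl_of_notMem (he : (v₀ : α) ∉ (e₀ : Set α))
    (f : H.vertexSet → R) (x : R) :
    ∑ v ∈ members (insert (.inl v₀) s) e₀, Function.update f v₀ x v =
      ∑ v ∈ members s e₀, f v := by
  have hnot : v₀ ∉ members s e₀ := by simp [members, he]
  have hmem : members (insert (.inl v₀) s) e₀ = members s e₀ := by
    simp only [members, toLeft_insert_inl, filter_insert, if_neg he]
  rw [hmem, sum_update_of_notMem hnot]

theorem mem_values_insert_vertex {F : State R M} (hF : F ≤ merge (τ e₀) (σ v₀))
    (he₀ : .inr e₀ ∈ s) (hv₀ : .inl v₀ ∉ s)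
    (hadj : ∀ e : H.edgeSet, .inr e ∈ s → ((v₀ : α) ∈ (e : Set α) ↔ e = e₀))
    {f : H.vertexSet → R} {p : M} (hp : p ∈ values σ (Function.update τ e₀ F) s f) :
    ∃ x, p ∈ values σ τ (insert (.inl v₀) s) (Function.update f v₀ x) := by
  set y := ∑ v ∈ members s e₀, f v with hy
  set A := ∑ v ∈ s.toLeft, σ v (f v)
  set B := ∑ e ∈ s.toRight.erase e₀, τ e (∑ v ∈ members s e, f v)
  have hold : values σ (Function.update τ e₀ F) s f = A + (F y + B) := by
    rw [values, ← add_sum_erase _ _ (mem_toRight.2 he₀), Function.update_self, ← hy]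
    congr 2
    refine sum_congr rfl fun e he ↦ ?_
    rw [Function.update_of_ne (ne_of_mem_erase he)]
  have hnew (x : R) : values σ τ (insert (.inl v₀) s) (Function.update f v₀ x) =
      A + (τ e₀ (y + x) + σ v₀ x + B) := by
    have hvert : ∑ v ∈ (insert (.inl v₀) s).toLeft, σ v (Function.update f v₀ x v) =
        σ v₀ x + A := by
      rw [toLeft_insert_inl, sum_insert (by simpa using hv₀), Function.update_self]
      congr 1
      refine sum_congr rfl fun v hv ↦ ?_
      rw [Function.update_of_ne (by rintro rfl; exact hv₀ (mem_toLeft.1 hv))]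
    rw [values, hvert, toRight_insert_inl, ← add_sum_erase _ _ (mem_toRight.2 he₀),
      sum_members_insert_inl_of_mem hv₀ ((hadj e₀ he₀).2 rfl), ← hy, add_comm x y,
      sum_congr (g := fun e ↦ τ e (∑ v ∈ members s e, f v)) rfl fun e he ↦ ?_]
    · abel
    · have hne := fun h ↦ ne_of_mem_erase he ((hadj e (mem_toRight.1 (mem_of_mem_erase he))).1 h)
      rw [sum_members_insert_inl_of_notMem hne]
  rw [hold] at hp
  obtain ⟨p₁, hp₁, _, ⟨q, hq, p₂, hp₂, rfl⟩, rfl⟩ := hp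
  obtain ⟨x, hx⟩ := Set.mem_iUnion.1 (hF y hq)
  exact ⟨x, hnew x ▸ Set.add_mem_add hp₁ (Set.add_mem_add hx hp₂)⟩

theorem values_subset_insert_edge {U : State R M} (hU : U ≤ σ v₀ + τ e₀)
    (hv₀ : .inl v₀ ∈ s) (he₀ : .inr e₀ ∉ s)
    (hadj : ∀ v : H.vertexSet, .inl v ∈ s → ((v : α) ∈ (e₀ : Set α) ↔ v = v₀))
    (f : H.vertexSet → R) :
    values (Function.update σ v₀ U) τ s f ⊆ values σ τ (insert (.inr e₀) s) f := by
  set A := ∑ v ∈ s.toLeft.erase v₀, σ v (f v)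
  set B := ∑ e ∈ s.toRight, τ e (∑ v ∈ members s e, f v)
  have hold : values (Function.update σ v₀ U) τ s f = U (f v₀) + (A + B) := by
    rw [values, ← add_sum_erase _ _ (mem_toLeft.2 hv₀), Function.update_self, add_assoc]
    congr 2
    refine sum_congr rfl fun v hv ↦ ?_
    rw [Function.update_of_ne (ne_of_mem_erase hv)]
  have hnew : values σ τ (insert (.inr e₀) s) f = (σ v₀ + τ e₀) (f v₀) + (A + B) := by
    rw [values, toLeft_insert_inr, toRight_insert_inr, sum_insert (by simpa using he₀),
      ← add_sum_erase _ _ (mem_toLeft.2 hv₀), Pi.add_apply]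
    simp only [members_insert_inr, members_eq_singleton hv₀ hadj, sum_singleton]
    abel
  rw [hold, hnew]
  exact Set.add_subset_add_right (hU _)

theorem IsClosedSystem.isAbsorbable_insert_vertex (h : IsClosedSystem a b 𝒰 ℱ)
    (hr : .inl r ∈ s) (he₀ : .inr e₀ ∈ s) (hv₀ : .inl v₀ ∉ s)
    (hadj : ∀ e : H.edgeSet, .inr e ∈ s → ((v₀ : α) ∈ (e : Set α) ↔ e = e₀))
    (hs : IsAbsorbable b 𝒰 ℱ r s) : IsAbsorbable b 𝒰 ℱ r (insert (.inl v₀) s) := by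
  intro σ τ hσ hτ
  have hτe₀ : τ e₀ ∈ insert (fun y ↦ {b y}) ℱ :=
    (hτ e₀ (mem_insert_of_mem he₀)).elim .inr fun hb ↦ .inl hb.1
  obtain ⟨F, hF, hFle⟩ := h.exists_le_merge _ hτe₀ _ (hσ v₀)
  obtain ⟨U, hU, hUs⟩ := hs σ (Function.update τ e₀ F) hσ fun e he ↦ by
    obtain rfl | hne := eq_or_ne e e₀
    · exact .inl (by rwa [Function.update_self])
    · rw [Function.update_of_ne hne]
      have hmem : members (insert (.inl v₀) s) e = members s e := by
        rw [members, toLeft_insert_inl, filter_insert, if_neg (mt (hadj e he).1 hne), members]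
      exact hmem ▸ hτ e (mem_insert_of_mem he)
  refine ⟨U, hU, fun x p hp ↦ ?_⟩
  obtain ⟨f, rfl, hf⟩ := hUs x p hp
  obtain ⟨z, hz⟩ := mem_values_insert_vertex hFle he₀ hv₀ hadj hf
  exact ⟨_, Function.update_of_ne (by rintro rfl; exact hv₀ hr) _ _, hz⟩

theorem IsClosedSystem.isAbsorbable_insert_edge (h : IsClosedSystem a b 𝒰 ℱ)
    (hv₀ : .inl v₀ ∈ s) (he₀ : .inr e₀ ∉ s)
    (hadj : ∀ v : H.vertexSet, .inl v ∈ s → ((v : α) ∈ (e₀ : Set α) ↔ v = v₀))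
    (hs : IsAbsorbable b 𝒰 ℱ r s) : IsAbsorbable b 𝒰 ℱ r (insert (.inr e₀) s) := by
  intro σ τ hσ hτ
  simp only [members_insert_inr] at hτ
  have hτe₀ : τ e₀ ∈ ℱ := (hτ e₀ (mem_insert_self _ s)).resolve_right fun hb ↦ by
    simp [members_eq_singleton hv₀ hadj] at hb
  obtain ⟨U', hU', hle⟩ := h.exists_le_add _ (hσ v₀) _ hτe₀
  obtain ⟨U, hU, hUs⟩ := hs (Function.update σ v₀ U') τ
    (Function.forall_update_iff σ (p := fun _ W ↦ W ∈ 𝒰) |>.2 ⟨hU', fun v _ ↦ hσ v⟩)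
    fun e he ↦ hτ e (mem_insert_of_mem he)
  refine ⟨U, hU, fun x p hp ↦ ?_⟩
  obtain ⟨f, hfr, hf⟩ := hUs x p hp
  exact ⟨f, hfr, values_subset_insert_edge hle hv₀ he₀ hadj f hf⟩

end DecidableEq

variable [Fintype H.vertexSet] [Fintype H.edgeSet]

theorem IsClosedSystem.isAbsorbable_univ (h : IsClosedSystem a b 𝒰 ℱ) (hH : H.IsHypertree)
    (r : H.vertexSet) : IsAbsorbable b 𝒰 ℱ r univ := by
  classical
  refine leaf_induction_of_isTree ⟨hH.1, hH.2⟩ (r := .inl r) isAbsorbable_singleton ?_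
  rintro s (v | e) (v' | e') hr ha hu hadj hs
  · exact ((hadj _ ha).2 rfl).elim
  · exact h.isAbsorbable_insert_edge ha hu
      (fun v hv ↦ (hadj _ hv).trans Sum.inl_injective.eq_iff) hs
  · exact h.isAbsorbable_insert_vertex hr ha hu
      (fun e he ↦ (hadj _ he).trans Sum.inr_injective.eq_iff) hs
  · exact ((hadj _ ha).2 rfl).elim

theorem IsClosedSystem.exists_achievable (h : IsClosedSystem a b 𝒰 ℱ) (hH : H.IsHypertree)
    (hcard : ∀ e ∈ H.edgeSet, 2 ≤ e.ncard) :
    ∃ U ∈ 𝒰, ∀ x, ∀ p ∈ U x, ∃ f : H.vertexSet → R,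
      ∑ v, a (f v) + ∑ e : H.edgeSet, b (∑ v ∈ members univ e, f v) = p := by
  obtain ⟨r⟩ : Nonempty H.vertexSet := by
    obtain ⟨v | e⟩ := hH.1.nonempty
    · exact ⟨v⟩
    · obtain ⟨v, -⟩ := card_pos.1 (two_pos.trans_le (two_le_card_members_univ (hcard e e.2)))
      exact ⟨v⟩
  obtain ⟨U₀, hU₀, hle⟩ := h.exists_le_vertex
  obtain ⟨U, hU, hUs⟩ := h.isAbsorbable_univ hH r (fun _ ↦ U₀) (fun _ y ↦ {b y}) (fun _ ↦ hU₀)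
    fun e _ ↦ .inr ⟨rfl, two_le_card_members_univ (hcard e e.2)⟩
  refine ⟨U, hU, fun x p hp ↦ ?_⟩
  obtain ⟨f, -, hf⟩ := hUs x p hp
  have hsub : values (fun _ ↦ U₀) (fun _ y ↦ {b y}) univ f ⊆
      {∑ v, a (f v) + ∑ e : H.edgeSet, b (∑ v ∈ members univ e, f v)} := by
    rw [values, toLeft_univ, toRight_univ, ← Set.singleton_add_singleton,
      ← Set.finsetSum_singleton, ← Set.finsetSum_singleton]
    exact Set.add_subset_add_right (Set.finsetSum_subset_finsetSum _ _ _ fun v _ ↦ hle (f v))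
  exact ⟨f, (hsub hf).symm⟩

end States

section Cordial

variable {k : ℕ}

/-- The label `x` in the coordinates in which cordiality is tested for `k ∈ {2, 3}`: summed over a
labeled set, they compare the numbers of labels `1` and `-1` with the number of labels `0`. For
`k = 2` the two coordinates agree. -/
def weight (x : ZMod k) : ℤ × ℤ :=
  ((if x = 1 then 1 else 0) - (if x = 0 then 1 else 0),
    (if x = -1 then 1 else 0) - (if x = 0 then 1 else 0))

/-- A total weight for which the numbers of labels `0`, `1` and `-1` differ by at most one. -/
def IsBalanced (p : ℤ × ℤ) : Prop :=
  |p.1| ≤ 1 ∧ |p.2| ≤ 1 ∧ |p.1 - p.2| ≤ 1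

instance : DecidablePred IsBalanced := fun _ ↦ inferInstanceAs (Decidable (_ ∧ _))

/-- The total weights of the labels of vertices and of the labels of edges. -/
abbrev Profile := (ℤ × ℤ) × (ℤ × ℤ)

theorem sum_weight {ι : Type*} [Fintype ι] (g : ι → ZMod k) :
    ∑ i, weight (g i) =
      ((#{i | g i = 1} - #{i | g i = 0} : ℤ), (#{i | g i = -1} - #{i | g i = 0} : ℤ)) := by
  ext <;> simp [weight, Prod.fst_sum, Prod.snd_sum]

theorem IsBalanced.abs_ncard_sub_ncard_le_one {ι : Type*} [Fintype ι] {g : ι → ZMod k}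
    (hg : IsBalanced (∑ i, weight (g i))) (hk : ∀ x : ZMod k, x = 0 ∨ x = 1 ∨ x = -1)
    (x y : ZMod k) :
    |({i | g i = x}.ncard : ℤ) - {i | g i = y}.ncard| ≤ 1 := by
  have hcard (z : ZMod k) : {i | g i = z}.ncard = #{i | g i = z} := by
    rw [← Set.ncard_coe_finset, coe_filter_univ]
  rw [sum_weight] at hg
  obtain ⟨h₁, h₂, h₃⟩ := hg
  simp only [abs_le] at h₁ h₂ h₃
  rw [hcard, hcard, abs_le]
  obtain rfl | rfl | rfl := hk x <;> obtain rfl | rfl | rfl := hk y <;> constructor <;> linarith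

variable {α : Type*} {H : Hypergraph α}

section Fintype

variable [Fintype H.vertexSet] [Fintype H.edgeSet]

theorem edgeLabel_eq_sum_members (f : H.vertexSet → ZMod k) (e : H.edgeSet) :
    H.edgeLabel f e = ∑ v ∈ members univ e, f v := by
  classical
  rw [Hypergraph.edgeLabel, finsum_eq_sum_of_fintype]
  simp [finsum_eq_if, members, sum_filter]

theorem isCordialLabeling_of_isBalanced (hk : ∀ x : ZMod k, x = 0 ∨ x = 1 ∨ x = -1)
    {f : H.vertexSet → ZMod k} (hV : IsBalanced (∑ v, weight (f v)))
    (hE : IsBalanced (∑ e : H.edgeSet, weight (∑ v ∈ members univ e, f v))) :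
    H.IsCordialLabeling f := by
  simp only [← edgeLabel_eq_sum_members] at hE
  exact fun x y ↦ ⟨hV.abs_ncard_sub_ncard_le_one hk x y, hE.abs_ncard_sub_ncard_le_one hk x y⟩

end Fintype

theorem IsClosedSystem.isCordial [Finite H.vertexSet] [Finite H.edgeSet]
    {𝒰 ℱ : Set (State (ZMod k) Profile)}
    (h : IsClosedSystem (fun x ↦ (weight x, 0)) (fun x ↦ (0, weight x)) 𝒰 ℱ)
    (hbal : ∀ U ∈ 𝒰, ∃ x, ∃ p ∈ U x, IsBalanced p.1 ∧ IsBalanced p.2)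
    (hk : ∀ x : ZMod k, x = 0 ∨ x = 1 ∨ x = -1) (hH : H.IsHypertree)
    (hcard : ∀ e ∈ H.edgeSet, 2 ≤ e.ncard) :
    H.IsCordial k := by
  cases nonempty_fintype H.vertexSet
  cases nonempty_fintype H.edgeSet
  obtain ⟨U, hU, hUf⟩ := h.exists_achievable hH hcard
  obtain ⟨x, p, hp, hV, hE⟩ := hbal U hU
  obtain ⟨f, rfl⟩ := hUf x p hp
  simp only [Prod.fst_add, Prod.fst_sum, Prod.snd_add, Prod.snd_sum, sum_const_zero, add_zero,
    zero_add] at hV hE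
  exact ⟨f, isCordialLabeling_of_isBalanced hk hV hE⟩

end Cordial

section Certificate

/-- The profile with four-digit code `n`, in which the digit `d` stands for the coordinate `d - 4`.
Thus the codes of two profiles add up to the code of their sum plus `4444`. -/
def decode (n : ℕ) : Profile :=
  (((n / 1000 : ℕ) - 4, (n / 100 % 10 : ℕ) - 4), ((n / 10 % 10 : ℕ) - 4, (n % 10 : ℕ) - 4))

/-- The last three digits of a code are between `1` and `7`, which rules out carries between the
two sides of `t + 4444 = p + q`. -/
def IsCode (n : ℕ) : Prop :=
  n / 100 % 10 ∈ Icc 1 7 ∧ n / 10 % 10 ∈ Icc 1 7 ∧ n % 10 ∈ Icc 1 7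

instance : DecidablePred IsCode := fun _ ↦ inferInstanceAs (Decidable (_ ∧ _))

theorem digit_add_eq_add {t p q c : ℕ} (ht : t % 10 ∈ Icc 1 7) (hp : p % 10 ∈ Icc 1 7)
    (hq : q % 10 ∈ Icc 1 7) (h : t + (10 * c + 4) = p + q) :
    t % 10 + 4 = p % 10 + q % 10 ∧ t / 10 + c = p / 10 + q / 10 := by
  simp only [mem_Icc] at ht hp hq
  omega

theorem decode_eq_add {t p q : ℕ} (ht : IsCode t) (hp : IsCode p) (hq : IsCode q)
    (h : t + 4444 = p + q) : decode t = decode p + decode q := by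
  obtain ⟨ht₂, ht₃, ht₄⟩ := ht
  obtain ⟨hp₂, hp₃, hp₄⟩ := hp
  obtain ⟨hq₂, hq₃, hq₄⟩ := hq
  obtain ⟨h₄, h⟩ := digit_add_eq_add (c := 444) ht₄ hp₄ hq₄ h
  obtain ⟨h₃, h⟩ := digit_add_eq_add (c := 44) ht₃ hp₃ hq₃ h
  simp only [Nat.div_div_eq_div_mul, Nat.reduceMul] at h
  obtain ⟨h₂, h₁⟩ := digit_add_eq_add (c := 4) ht₂ hp₂ hq₂ h
  simp only [Nat.div_div_eq_div_mul, Nat.reduceMul] at h₁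
  simp only [decode, Prod.mk_add_mk, Prod.mk.injEq]
  refine ⟨⟨?_, ?_⟩, ?_, ?_⟩ <;> lia

/-- The union of a list of sets of natural numbers, each given as the set of the positions of the
bits `1` of a natural number. This encoding makes the computations with sets of codes fast, since
the kernel has native bitwise operations. -/
def unionMask {ι : Type*} (l : List ι) (g : ι → ℕ) : ℕ :=
  l.foldr (fun i m ↦ g i ||| m) 0

theorem testBit_unionMask {ι : Type*} {l : List ι} {g : ι → ℕ} {n : ℕ} :
    (unionMask l g).testBit n ↔ ∃ i ∈ l, (g i).testBit n := by
  induction l with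
  | nil => simp [unionMask]
  | cons i l ih =>
    rw [unionMask, List.foldr_cons, ← unionMask, Nat.testBit_or, Bool.or_eq_true, ih,
      List.exists_mem_cons_iff]

/-- The bit set of the elements of a list. -/
def mask (l : List ℕ) : ℕ :=
  unionMask l (1 <<< ·)

theorem testBit_mask {l : List ℕ} {n : ℕ} : (mask l).testBit n ↔ n ∈ l := by
  simp [mask, testBit_unionMask, Nat.one_shiftLeft, Nat.testBit_two_pow]

/-- The sumset of the lists `l` and `l'`, as a bit set. -/
def sumMask (l l' : List ℕ) : ℕ :=
  unionMask l' (mask l <<< ·)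

theorem testBit_sumMask {l l' : List ℕ} {n : ℕ} :
    (sumMask l l').testBit n ↔ ∃ p ∈ l, ∃ q ∈ l', n = p + q := by
  simp only [sumMask, testBit_unionMask, Nat.testBit_shiftLeft, Bool.and_eq_true,
    decide_eq_true_iff, testBit_mask]
  constructor
  · rintro ⟨q, hq, hle, hp⟩
    exact ⟨n - q, hp, q, hq, (Nat.sub_add_cancel hle).symm⟩
  · rintro ⟨p, hp, q, hq, rfl⟩
    exact ⟨q, hq, Nat.le_add_left q p, by simpa using hp⟩

theorem exists_decode_eq_add {l l' : List ℕ} {t : ℕ} (ht : IsCode t) (hl : ∀ p ∈ l, IsCode p)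
    (hl' : ∀ q ∈ l', IsCode q) (h : (sumMask l l').testBit (t + 4444)) :
    ∃ p ∈ l, ∃ q ∈ l', decode t = decode p + decode q := by
  obtain ⟨p, hp, q, hq, heq⟩ := testBit_sumMask.1 h
  exact ⟨p, hp, q, hq, decode_eq_add ht (hl p hp) (hl' q hq) heq⟩

/-- A table whose `x`-th entry lists the codes of the profiles in the state at the label `x`. -/
abbrev Table := List (List ℕ)

/-- The state listed by a table. -/
def Table.toState (k : ℕ) (S : Table) : State (ZMod k) Profile :=
  fun x ↦ {p | p ∈ (S.getD x.val []).map decode}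

/-- All entries of the table are codes within the range of `decode_eq_add`. -/
def Table.IsValid (S : Table) : Prop :=
  ∀ l ∈ S, ∀ n ∈ l, IsCode n

instance : DecidablePred Table.IsValid := fun _ ↦ inferInstanceAs (Decidable (∀ _, _))

theorem mem_of_mem_getD {S : Table} {x n : ℕ} (hn : n ∈ S.getD x []) : ∃ l ∈ S, n ∈ l := by
  obtain hx | hx := lt_or_ge x S.length
  · rw [List.getD_eq_getElem _ _ hx] at hn
    exact ⟨_, List.getElem_mem hx, hn⟩
  · rw [List.getD_eq_default _ _ hx] at hn
    exact absurd hn List.not_mem_nil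

theorem Table.IsValid.isCode {S : Table} (h : S.IsValid) {x n : ℕ} (hn : n ∈ S.getD x []) :
    IsCode n := by
  obtain ⟨l, hl, hnl⟩ := mem_of_mem_getD hn
  exact h l hl n hnl

theorem Table.toState_eq_singleton {k : ℕ} {S : Table} {f : ZMod k → Profile}
    (h : ∀ x : ZMod k, (S.getD x.val []).map decode = [f x]) : S.toState k = fun x ↦ {f x} := by
  ext x p
  simp only [Table.toState, h x, List.mem_singleton, Set.mem_ofPred_eq, Set.mem_singleton_iff]

/-- The codes of the sum of two states at the label `x`, before the subtraction of `4444`. -/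
def addMask (U F : Table) (x : ℕ) : ℕ :=
  sumMask (U.getD x []) (F.getD x [])

/-- The codes of `merge` at the label `y`, before the subtraction of `4444`. -/
def mergeMask (k : ℕ) (F U : Table) (y : ℕ) : ℕ :=
  unionMask (List.range k) fun x ↦ sumMask (U.getD x []) (F.getD ((y + x) % k) [])

/-- The codes in `T`, increased by `4444`, belong to the bit sets `S`. -/
def IsCovered (k : ℕ) (T : Table) (S : ℕ → ℕ) : Prop :=
  ∀ x < k, (mask (T.getD x []) <<< 4444) &&& S x = mask (T.getD x []) <<< 4444

instance {k : ℕ} {T : Table} {S : ℕ → ℕ} : Decidable (IsCovered k T S) :=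
  inferInstanceAs (Decidable (∀ _, _))

theorem IsCovered.testBit {k : ℕ} {T : Table} {S : ℕ → ℕ} (h : IsCovered k T S) {x t : ℕ}
    (hx : x < k) (ht : t ∈ T.getD x []) : (S x).testBit (t + 4444) := by
  have hT : (mask (T.getD x []) <<< 4444).testBit (t + 4444) := by
    simpa [Nat.testBit_shiftLeft] using testBit_mask.2 ht
  rw [← h x hx, Nat.testBit_and, Bool.and_eq_true] at hT
  exact hT.2

variable {k : ℕ} [NeZero k] {T U F : Table} {a b : ZMod k → Profile}

theorem IsCovered.toState_le_add (h : IsCovered k T (addMask U F)) (hT : T.IsValid)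
    (hU : U.IsValid) (hF : F.IsValid) : T.toState k ≤ U.toState k + F.toState k := by
  intro x _ hp
  obtain ⟨t, ht, rfl⟩ := List.mem_map.1 hp
  obtain ⟨p, hp, q, hq, heq⟩ := exists_decode_eq_add (hT.isCode ht) (fun _ ↦ hU.isCode)
    (fun _ ↦ hF.isCode) (h.testBit (ZMod.val_lt x) ht)
  exact heq ▸ Set.add_mem_add (List.mem_map_of_mem hp) (List.mem_map_of_mem hq)

theorem IsCovered.toState_le_merge (h : IsCovered k T (mergeMask k F U)) (hT : T.IsValid)
    (hU : U.IsValid) (hF : F.IsValid) : T.toState k ≤ merge (F.toState k) (U.toState k) := by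
  intro y _ hp
  obtain ⟨t, ht, rfl⟩ := List.mem_map.1 hp
  obtain ⟨x, hx, hbit⟩ := testBit_unionMask.1 (h.testBit (ZMod.val_lt y) ht)
  obtain ⟨p, hp, q, hq, heq⟩ := exists_decode_eq_add (hT.isCode ht) (fun _ ↦ hU.isCode)
    (fun _ ↦ hF.isCode) hbit
  have hval : (x : ZMod k).val = x := ZMod.val_cast_of_lt (List.mem_range.1 hx)
  refine Set.mem_iUnion.2 ⟨x, ?_⟩
  rw [heq, add_comm (decode p)]
  refine Set.add_mem_add (List.mem_map_of_mem ?_) (List.mem_map_of_mem ?_)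
  · rwa [ZMod.val_add, hval]
  · rwa [hval]

/-- The decidable counterpart of `IsClosedSystem`, with initial edge state `F₀`. -/
def AreClosed (k : ℕ) (F₀ : Table) (us fs : List Table) : Prop :=
  (∀ S ∈ F₀ :: (us ++ fs), S.IsValid) ∧
    ∀ U ∈ us, (∀ F ∈ fs, ∃ T ∈ us, IsCovered k T (addMask U F)) ∧
      ∀ F ∈ F₀ :: fs, ∃ T ∈ fs, IsCovered k T (mergeMask k F U)

instance {k : ℕ} {F₀ : Table} {us fs : List Table} : Decidable (AreClosed k F₀ us fs) :=
  inferInstanceAs (Decidable (_ ∧ _))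

theorem AreClosed.isClosedSystem {F₀ : Table} {us fs : List Table} (h : AreClosed k F₀ us fs)
    (hU₀ : ∃ U ∈ us, ∀ x : ZMod k, (U.getD x.val []).map decode = [a x])
    (hF₀ : ∀ y : ZMod k, (F₀.getD y.val []).map decode = [b y]) :
    IsClosedSystem a b (Table.toState k '' {U | U ∈ us}) (Table.toState k '' {F | F ∈ fs}) := by
  obtain ⟨hvalid, hclosed⟩ := h
  have hus : ∀ U ∈ us, U.IsValid := fun U hU ↦ hvalid U (by simp [hU])
  have hfs : ∀ F ∈ F₀ :: fs, F.IsValid := fun F hF ↦ hvalid F (by grind)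
  refine ⟨?_, ?_, ?_⟩
  · obtain ⟨U, hU, ha⟩ := hU₀
    exact ⟨_, ⟨U, hU, rfl⟩, (Table.toState_eq_singleton ha).le⟩
  · rintro _ ⟨U, hU, rfl⟩ _ ⟨F, hF, rfl⟩
    obtain ⟨T, hT, hcov⟩ := (hclosed U hU).1 F hF
    exact ⟨_, ⟨T, hT, rfl⟩, hcov.toState_le_add (hus T hT) (hus U hU) (hfs F (.tail _ hF))⟩
  · intro F' hF' _ ⟨U, hU, hU'⟩
    obtain ⟨F, hF, rfl⟩ : ∃ F ∈ F₀ :: fs, F.toState k = F' := by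
      obtain rfl | ⟨F, hF, rfl⟩ := hF'
      · exact ⟨F₀, .head _, Table.toState_eq_singleton hF₀⟩
      · exact ⟨F, .tail _ hF, rfl⟩
    obtain ⟨T, hT, hcov⟩ := (hclosed U hU).2 F hF
    exact ⟨_, ⟨T, hT, rfl⟩,
      hU' ▸ hcov.toState_le_merge (hfs T (.tail _ hT)) (hus U hU) (hfs F hF)⟩

end Certificate

section Tables

/-- The vertex states of a closed system for `k = 2`. -/
def vertexTables₂ : List Table :=
  [[[3344], [5544]], [[2233, 4455], [4455, 6633]], [[1133, 3355, 5533], [3355, 5533, 7755]],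
    [[2244, 6644], [4444, 6622, 6666]], [[3333, 3355], [5533, 5555]], [[1144, 5544], [3344, 7744]],
    [[2244, 4444], [4444, 6644]], [[2255, 4433], [4433, 6655]], [[2222, 2266, 4444], [4422, 4466,
    6644]], [[1155, 3333, 5555], [3333, 5555, 7733]]]

/-- The edge states of a closed system for `k = 2`. -/
def edgeTables₂ : List Table :=
  [[[3333, 5555], [3355, 5533]], [[2233, 4455, 6633], [2255, 4433, 6655]], [[3344, 5544], [3344,
    5544]], [[3355, 5533], [3333, 5555]], [[4444, 6644], [2244, 4444]], [[2255, 4433, 6655], [2233,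
    4455, 6633]], [[2233, 4433, 4455], [2255, 4433, 4455]], [[2244, 4444], [4444, 6644]]]

theorem isClosedSystem₂ :
    IsClosedSystem (fun x : ZMod 2 ↦ (weight x, 0)) (fun x ↦ (0, weight x))
      (Table.toState 2 '' {U | U ∈ vertexTables₂})
      (Table.toState 2 '' {F | F ∈ edgeTables₂}) :=
  AreClosed.isClosedSystem (F₀ := [[4433], [4455]]) (by decide +kernel) (by decide +kernel)
    (by decide)

theorem exists_isBalanced_of_mem_vertexTables₂ :
    ∀ U ∈ vertexTables₂, ∃ x, ∃ p ∈ U.toState 2 x, IsBalanced p.1 ∧ IsBalanced p.2 :=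
  show ∀ U ∈ vertexTables₂, ∃ x : ZMod 2, ∃ p ∈ (U.getD x.val []).map decode,
    IsBalanced p.1 ∧ IsBalanced p.2 by decide +kernel

/-- The vertex states of a closed system for `k = 3`. -/
def vertexTables₃ : List Table :=
  [[[3344], [5444], [4544]], [[2233, 3445, 4354], [4354, 5533, 6445], [3445, 4654, 5533]], [[2334,
    3243, 3546, 4455, 5364], [3264, 4443, 5355, 5622, 6534], [2346, 3555, 4434, 5643, 6522]],
    [[1133, 2345, 3254, 3554, 4433, 5345], [3254, 4433, 5345, 5645, 6554, 7433], [2345, 3554, 4433,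
    4733, 5645, 6554]], [[1234, 2443, 3355, 4234, 4534, 4564, 5443, 6355], [3343, 4255, 4555, 5434,
    6343, 6643, 7555], [2455, 3334, 3634, 4543, 5455, 5755, 6634]], [[2244, 2544, 3423, 4365, 5244,
    5544], [4344, 4644, 5523, 5553, 5556, 6432, 6465, 7644], [3444, 4623, 4656, 5532, 5535, 6444,
    6744]], [[2255, 2555, 3134, 3434, 4343, 4346, 5555], [2243, 3455, 4334, 4364, 5543, 6422, 6455,
    7634], [2234, 2534, 3443, 3446, 4355, 4655, 5534, 6743]], [[2455, 3334, 3343, 3355, 4255],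
    [4534, 5434, 5443, 5455, 6643], [2443, 4534, 4543, 4555, 5443, 6634, 6643]], [[1144, 2356,
    3232, 3565, 4144, 4444, 5356, 6565], [2332, 3244, 3544, 4453, 4456, 5332, 6544], [2344, 3223,
    3523, 4435, 4465, 5344, 5644]], [[2455, 3334, 3343, 3355, 4255, 4555, 5443], [5434, 5443,
    5455], [3334, 4534, 4543, 4555, 6643]], [[1245, 2154, 2454, 3333, 4245, 4545, 5454], [3333,
    4245, 4545, 5454, 6333, 6633, 7545], [2454, 3333, 3633, 4545, 5454, 5754, 6633]], [[2454, 3333,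
    3345, 3354, 4254, 4533, 4545, 4554, 5445, 5454], [3333, 4545, 5433, 5445, 5454, 6645], [3333,
    4533, 4545, 4554, 5454, 6654]], [[2133, 2454, 3333, 3345, 3354, 4533, 4554, 5433, 5445], [3333,
    4545, 4554, 5433, 5445, 5454], [3333, 4533, 4545, 4554, 5445, 5454]], [[2234, 2243, 3434, 3443,
    3455, 4355], [4334, 4343, 4355, 5543, 5555, 6434, 6455], [3434, 3443, 3455, 4655, 5534, 5543,
    5555]], [[2334, 3243, 3555, 4434, 4443, 5355], [3243, 4434, 4455, 5355, 5643, 6534], [2334,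
    3555, 4443, 4455, 5643, 6534]], [[1344, 2244, 3144, 3444, 4344, 5544], [4344, 5544, 6444],
    [3444, 4644, 5544]], [[2333, 2345, 2354, 3233, 3245, 3254, 3545, 4433, 4445, 4454], [3254,
    4433, 5345, 5354, 5633, 6533, 6545], [2345, 3545, 3554, 4433, 5633, 5654, 6533]], [[2455, 3343,
    3355, 4234, 4243, 4255, 4534, 4543, 6643], [3343, 4534, 4543, 4555, 5434, 5455, 6643, 7534],
    [2434, 2455, 3655, 4543, 4555, 5434, 5443, 5455]], [[2333, 2345, 3254, 3545, 4445, 4454, 5354],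
    [3254, 4445, 5333, 5345, 5354, 6533, 6545, 6554], [3545, 3554, 4433, 4445, 4454, 5633, 5645,
    5654]], [[2434, 3334, 3343, 3355, 4555, 5455], [4255, 4534, 5434, 5443, 5455, 6643], [2434,
    4534, 4543, 4555, 5443, 6634]], [[2455, 3334, 3343, 3355, 4255, 4555, 5443], [5434, 5443, 5455,
    6634], [3343, 4534, 4543, 4555]], [[1234, 2443, 2455, 3334, 3343, 4234, 4255], [3355, 4543,
    5434, 5443, 7543, 7555], [3343, 3355, 3655, 4534, 4543, 5434, 5755, 6643]], [[2333, 2345, 2354,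
    3233, 3245, 3254, 3545, 3554, 4454, 5345], [4424, 4433, 4445, 4454, 5345, 6533, 6542, 6545,
    6554], [2345, 3233, 3545, 3554, 4454, 5633, 5645, 5654, 6533]], [[2333, 2354, 3233, 3245, 3545,
    4433, 4445, 4454, 4466], [3554, 4433, 4445, 5354, 6533, 6545, 6554], [1445, 2333, 2354, 3545,
    3554, 4433, 4454, 5345, 5654]], [[2234, 2243, 3455, 4343, 4355, 5534], [4334, 4343, 4355, 4643,
    5534, 6434, 6455], [3434, 3443, 3455, 4643, 5534, 5543, 6434]], [[3333, 3345, 3354, 4554, 5433,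
    5445, 5454], [3333, 3354, 4254, 4554, 5433, 5445, 6633, 7545], [2445, 2454, 4533, 4554, 5433,
    5445, 6633]], [[2233, 3424, 3433, 3454, 4342, 4345, 4645, 5533, 5566], [2233, 2254, 3442, 4333,
    4345, 4366, 4633, 5524, 5545, 5554, 6445], [1345, 2233, 2245, 3433, 3454, 3466, 4324, 4354,
    4654, 5542, 5545, 5554]], [[3333, 3345, 3354, 4545, 4554, 5445, 5454], [3333, 4545, 5433, 5445,
    5454, 6645, 6654], [3333, 4533, 4545, 4554, 5454, 6645, 6654]], [[2445, 3333, 3345, 3354, 4254,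
    4554, 5445, 5454], [3333, 4545, 4554, 5433, 5445, 5454], [3333, 4533, 4545, 4554, 5454, 6654]],
    [[2345, 2354, 3233, 3245, 3254, 3554, 4433, 4454, 5345], [4424, 4433, 4442, 4445, 4454, 5333,
    5345, 5645, 6545, 6554], [2345, 3233, 3533, 3554, 4424, 4445, 4454, 5645, 6554]], [[2333, 2354,
    3233, 3245, 3254, 3533, 3554, 4433, 4445, 4454], [3233, 3254, 4445, 4454, 5333, 5354, 5645,
    5654, 6545], [2333, 2345, 3533, 3545, 4445, 4454, 5633, 5654, 6545, 6554]], [[2455, 3334, 3343,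
    3355, 4255, 5443], [4234, 4255, 4534, 4543, 4555, 5443, 5455, 6634], [2443, 2455, 4534, 4555,
    5434, 5443, 5455]], [[3434, 3443, 3455, 4343, 4355, 5543], [2243, 4343, 4355, 4364, 4643, 5534,
    6434, 7634], [2234, 3422, 3434, 3446, 3455, 5543, 5555, 6434, 6743]], [[2234, 2243, 3455, 4343,
    4355, 5534], [3443, 4334, 4343, 5534, 5555, 6443, 6455], [3434, 3443, 4334, 4634, 4655, 5543,
    5555]], [[3333, 3345, 3354, 4545, 4554, 5445, 5454], [3333, 5433, 5445, 5454, 5466, 6633],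
    [3333, 4533, 4545, 4554, 4566, 6633]], [[3423, 3444, 3456, 4344, 4365], [3444, 4344, 5544,
    6444, 7644], [2265, 3435, 3444, 4344, 4644, 5535, 5544]], [[2444, 3353, 4244, 4532, 4544, 4556,
    5432, 5444, 5465, 7544], [3323, 3335, 3344, 3353, 3356, 3644, 4244, 4532, 4544, 4565, 5423,
    5456, 5465, 6644], [2444, 3335, 3344, 3353, 3365, 4532, 4556, 5423, 5444, 5456, 6344, 6644]],
    [[2333, 2345, 3233, 3254, 3545, 4433, 4445, 4454, 5354], [3254, 5345, 5354, 5633, 6533, 6545,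
    6554], [3545, 3554, 4433, 4445, 5633, 5645, 5654]], [[2434, 3334, 3355, 4243, 4555, 5443,
    5455], [3343, 5434, 5443, 5455, 6643], [3334, 4534, 4543, 4555, 6634]], [[2244, 3444, 3456,
    4344, 5544], [4344, 5544, 6444, 7644], [3435, 3444, 4644, 5535, 5544]], [[1234, 1243, 2134,
    2455, 3343, 4255, 4534, 4555, 5455], [4534, 5434, 5443, 5455], [3343, 3355, 4534, 4543, 4555,
    6643]], [[2333, 2345, 2354, 3233, 3245, 3254, 4445, 4454], [4433, 4445, 5333, 5345, 5354, 6533,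
    6545], [3533, 3545, 3554, 4433, 4445, 4454, 5654]], [[2455, 3334, 3343, 3355, 4255], [4243,
    4534, 5434, 5443, 5455], [2434, 4534, 4543, 4555, 5443, 6643]], [[1344, 2244, 3144, 3444,
    4344], [3444, 4332, 4344, 5532, 5544, 6444], [2544, 3444, 4344, 4644, 5544]], [[2334, 3243,
    3255, 3534, 4434, 4443, 4455, 5343], [4434, 4443, 4455, 6534, 6555], [4434, 4443, 4455, 5643]],
    [[3433, 3445, 3454, 4333, 4354, 4645, 6454], [3454, 4345, 4354, 5533, 5545, 5554], [2233, 3445,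
    3454, 4345, 5533, 5545, 5554]], [[2343, 3234, 3534, 4434, 4443, 4455, 5343], [2355, 3234, 4434,
    4443, 5334, 5634, 6555], [2355, 3234, 3255, 3543, 4434, 4443, 5655, 6543]], [[1344, 2244, 3444,
    3453, 4344, 4356, 5244, 5544], [3444, 4335, 4344, 4644, 5244, 5532, 5544, 5556, 7644], [2244,
    2544, 3435, 3444, 4344, 5544, 6444, 6744]], [[2344, 3244, 4444], [3244, 4444, 5344, 5644,
    6544], [2344, 3544, 4444, 5644, 6544]], [[3333, 3345, 3354, 4545, 4554, 5445, 5454], [4245,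
    5433, 5445, 5454, 6633, 6645], [3333, 3345, 4533, 4545, 4554, 6633, 6654]], [[3333, 3345, 3354,
    4233, 4554], [4245, 4254, 4545, 4554, 5433, 5445, 5454, 6654], [3333, 3345, 4533, 4545, 4554,
    5433, 5445, 5454]], [[2234, 3434, 3455, 4343, 4355], [4334, 4343, 5534, 5555, 6443, 6455],
    [2234, 3434, 4634, 4655, 5543, 5555]], [[3433, 3445, 4333, 4354, 4633, 5545, 5554, 6433],
    [2245, 3454, 4345, 4354, 4645, 5533, 5545], [2254, 3445, 3454, 4345, 5533, 5554, 6454]],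
    [[2143, 2455, 3334, 3343, 4255, 4534, 4555, 5455], [4543, 4555, 5434, 5443, 6355, 6634], [2434,
    3343, 4534, 4543, 5434, 5455, 5755]], [[2354, 3245, 4433, 4445, 4454, 4466, 5333, 5345, 5633,
    5654], [2354, 3233, 3254, 3533, 4445, 4454, 5345, 5633, 6533, 6554], [2333, 2345, 3245, 3254,
    3545, 3554, 4424, 4433, 4445, 5654, 6554]], [[2244, 3444, 4344, 5544], [4344, 5544, 6444,
    7644], [3444, 4644, 5544, 6744]], [[1344, 3144, 3444, 3456, 4344, 4365, 5544], [3444, 4344,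
    4353, 5544, 6444], [2265, 2544, 3444, 4344, 4644, 5544]], [[2243, 3455, 4334, 4343, 4355,
    4634], [3455, 4334, 4343, 5534, 5543, 5555], [2255, 3434, 3443, 3455, 5534, 5543, 5555, 6434]],
    [[3333, 3345, 3354, 4545, 5454], [3333, 4533, 5433, 5445, 5454, 6633, 6645], [3333, 4533, 4545,
    4554, 5433, 6633, 6654]], [[3434, 3455, 4343, 4355, 5555], [2243, 3443, 4334, 4343, 5543, 5555,
    6434, 6455], [2234, 3434, 3455, 4655, 5534, 5543, 5555]], [[2333, 2345, 2354, 3233, 3245, 3254,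
    3545, 4424, 4454], [3254, 4424, 4445, 4454, 5345, 5354, 6533, 6545, 6554], [2333, 2345, 3545,
    3554, 4454, 5633, 5645, 5654]], [[2244, 3444, 4344], [3444, 4344, 5544, 5553, 6432, 6444],
    [3444, 4344, 4644, 5544, 6744]], [[2334, 3243, 4434, 4443, 4455, 5355], [3543, 4434, 4443,
    4455, 5355, 5634, 6534], [2334, 2355, 3543, 4434, 4443, 4455, 5655, 6534]], [[2244, 3444,
    4344], [3444, 4344, 5544, 6444, 7644], [3444, 4344, 4644, 5544, 6744]], [[2333, 2345, 3254,
    3545, 4445, 4454, 5354], [3254, 4433, 4445, 4454, 5345, 5354, 6545, 6554], [3545, 3554, 4433,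
    4445, 4454, 5633, 5645, 5654]], [[2434, 3334, 3343, 3355, 4243, 4555, 5455], [3343, 4534, 5434,
    5443, 5455, 6643], [3334, 3355, 4534, 4543, 4555, 6634]], [[2333, 3233, 3545, 4433, 4445, 4454,
    4466, 5345, 5645, 6533], [2333, 3245, 3545, 4433, 4445, 4454, 5345, 6533, 6554], [2333, 3233,
    3245, 3254, 3545, 4433, 4445, 5645, 5654, 6554]]]

/-- The edge states of a closed system for `k = 3`. -/
def edgeTables₃ : List Table :=
  [[[3333, 4545, 5454], [3354, 4533, 5445], [3345, 4554, 5433]], [[2233, 3445, 4354, 4654, 5533,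
    6445], [2254, 3433, 4345, 4645, 5554, 6433], [2245, 3454, 4333, 4633, 5545, 6454]], [[2334,
    3243, 3555, 4434, 4443, 4455, 5355, 5643, 6534], [2334, 3234, 3534, 4434, 4443, 4455, 5343,
    5643, 6543], [2343, 2355, 3243, 3534, 4434, 4443, 4455, 5343, 6534, 6543]], [[2345, 3254, 3554,
    4433, 5345, 5645, 6554], [2333, 3245, 3545, 4454, 5333, 5633, 6545], [2354, 3233, 3533, 4445,
    5354, 5654, 6533]], [[3434, 4343, 4655, 5534, 5543, 6455], [2243, 3434, 3455, 4355, 4643,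
    5534], [2234, 3455, 4343, 4355, 5543, 6434]], [[2444, 3344, 4244, 4544, 5444, 6644], [3344,
    4544, 5444], [3344, 4544, 5444]], [[4444, 5644, 6544], [2344, 3544, 4444], [3244, 4444, 5344]],
    [[3334, 3343, 4534, 4543, 4555, 5434, 5443, 5455], [3334, 3343, 3355, 4543, 4555, 5434, 5455],
    [3334, 3343, 3355, 4543, 4555, 5434, 5443, 5455]], [[2334, 2343, 3234, 3534, 3555, 4434, 4443,
    4455, 5334, 5355, 5643, 5655, 6543], [2334, 3243, 3555, 4434, 4443, 4455, 5343, 5634, 5643],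
    [2334, 3243, 3555, 4434, 4443, 4455, 5355, 6555]], [[2334, 3243, 3543, 3555, 4434, 4443, 5334,
    5355, 5655, 6555], [2334, 2355, 3255, 3543, 4434, 4443, 5355, 5634, 6543, 6555], [3243, 3255,
    3555, 4434, 4443, 5334, 5634, 5655, 6543]], [[2333, 2345, 3554, 4433, 4445, 4454, 5354, 5654,
    6533, 6545, 6554], [2333, 2354, 3254, 3545, 3554, 4433, 4445, 5633, 5654, 6545, 6554], [2345,
    2354, 4433, 4454, 5333, 5345, 5633, 6533, 6554]], [[2233, 3433, 3445, 3454, 4333, 4345, 4354,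
    4633, 4654, 5533, 5545, 5554, 6433], [2233, 2254, 3445, 3454, 4333, 4354, 4645, 4654, 5533,
    5545], [2233, 2245, 3433, 3445, 4345, 4354, 5533, 5554, 6445, 6454]], [[2334, 3534, 3555, 4434,
    4443, 4455, 5355, 5655, 6543, 6555], [2334, 3243, 3255, 3534, 4434, 4443, 4455, 5643, 6543],
    [2334, 2355, 3243, 4434, 4443, 4455, 5343, 5643, 5655, 6534, 6555]], [[2443, 3334, 3343, 4234,
    4534, 4555, 5443, 5455, 6634], [2443, 3334, 3343, 4534, 4555, 5443, 5455], [3334, 3343, 4234,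
    4534, 4555, 5443, 5455]], [[3433, 3445, 4333, 4354, 4645, 5533, 5545, 5554, 6454], [2254, 3433,
    3454, 4345, 4354, 4633, 5533, 5545, 5554], [2245, 3445, 3454, 4333, 4345, 5533, 5545, 5554,
    6433]], [[2334, 2343, 3234, 3534, 3555, 4434, 4443, 5355, 5634, 5655, 6543, 6555], [2334, 3243,
    3534, 3555, 4434, 4443, 4455, 5355], [2334, 3243, 3255, 3555, 4434, 4443, 4455, 6534, 6543]],
    [[3433, 3445, 3454, 4333, 4345, 4354, 4645, 5545, 5554], [2254, 3433, 3445, 3454, 4333, 4345,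
    4354, 4633, 5533, 5545], [3433, 3445, 3454, 4333, 4345, 4354, 5554, 6433]], [[3434, 4343, 4355,
    4634, 5534, 5543, 5555, 6443], [3434, 3443, 3455, 4343, 4355, 5534, 5543, 5555], [3434, 3455,
    4334, 4343, 4355, 5543, 5555]], [[3234, 3534, 3543, 4434, 4443, 4455, 5634, 5655, 6555], [2343,
    3243, 3255, 3534, 4434, 4443, 4455, 5334, 5643, 6543], [2334, 3234, 3534, 3543, 4434, 4443,
    4455, 5343, 5643, 6534]], [[3233, 3545, 4433, 4445, 4454, 5333, 5345, 5654], [3245, 3254, 3545,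
    3554, 4433, 4445, 4454, 5354, 5654], [2345, 2354, 3233, 3245, 3545, 4433, 4445, 4454, 5333,
    5345, 5354, 6545, 6554]], [[2334, 3243, 3555, 4434, 4443, 5355, 5634, 5655, 6555], [2343, 3255,
    3543, 3555, 4434, 4443, 4455, 5355, 5634, 6555], [2334, 3243, 3555, 4434, 4443, 4455, 5334,
    5355, 5655, 6534]], [[2334, 2343, 3234, 3534, 4434, 4443, 4455, 5655, 6543, 6555], [2343, 3255,
    3534, 4434, 4443, 4455, 5334, 5355, 5643], [2334, 2355, 3543, 3555, 4434, 4443, 4455, 5343,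
    6534]], [[2345, 3533, 3545, 4433, 4445, 4454, 5354, 5645, 5654, 6545, 6554], [2333, 3254, 3545,
    3554, 4433, 4445, 4454, 5333, 6545], [2333, 2345, 3233, 4433, 4445, 4454, 5354, 5633, 6533,
    6554]], [[2345, 3254, 3545, 4433, 4445, 4454, 5645, 5654, 6545, 6554], [3245, 4433, 4445, 4454,
    5345, 5633, 5645], [2345, 3233, 3245, 4433, 4445, 4454, 5654, 6533, 6554]], [[3444, 4344,
    5544], [2244, 3444, 4344, 4644, 5544], [2244, 3444, 4344, 5544, 6444]], [[3344, 4544, 5444],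
    [2444, 3344, 4544, 5444, 6644], [3344, 4244, 4544, 5444, 6644]]]

theorem isClosedSystem₃ :
    IsClosedSystem (fun x : ZMod 3 ↦ (weight x, 0)) (fun x ↦ (0, weight x))
      (Table.toState 3 '' {U | U ∈ vertexTables₃})
      (Table.toState 3 '' {F | F ∈ edgeTables₃}) :=
  AreClosed.isClosedSystem (F₀ := [[4433], [4454], [4445]]) (by decide +kernel) (by decide +kernel)
    (by decide)

theorem exists_isBalanced_of_mem_vertexTables₃ :
    ∀ U ∈ vertexTables₃, ∃ x, ∃ p ∈ U.toState 3 x, IsBalanced p.1 ∧ IsBalanced p.2 :=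
  show ∀ U ∈ vertexTables₃, ∃ x : ZMod 3, ∃ p ∈ (U.getD x.val []).map decode,
    IsBalanced p.1 ∧ IsBalanced p.2 by decide +kernel

end Tables

end HypertreeCordial

theorem theorem1 {α : Type*} (H : Hypergraph α) (hfin : H.vertexSet.Finite)
    (hcard : ∀ e ∈ H.edgeSet, 2 ≤ e.ncard) (hH : H.IsHypertree) (k : ℕ) (hk : k = 2 ∨ k = 3) :
    H.IsCordial k := by
  have : Finite H.vertexSet := hfin
  have : Finite H.edgeSet := hfin.powerset.subset H.edgeSet_subset_powerset_vertexSet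
  obtain rfl | rfl := hk
  · exact HypertreeCordial.isClosedSystem₂.isCordial
      (Set.forall_mem_image.2 HypertreeCordial.exists_isBalanced_of_mem_vertexTables₂)
      (by decide) hH hcard
  · exact HypertreeCordial.isClosedSystem₃.isCordial
      (Set.forall_mem_image.2 HypertreeCordial.exists_isBalanced_of_mem_vertexTables₃)
      (by decide) hH hcard
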